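/- Let $p>2$ and let $N\ge 1$ be an integer. Let $B_1$ be the open unit ball of $\mathbb R^N$, and let $\partial B_1$ carry its surface measure. There is a constant $C$ depending only on $p$ and $N$ such that the following holds. Let $f\in L^\infty(B_1)$ and $v\in L^\infty(\partial B_1)\cap W^{1-\frac1p,p}(\partial B_1)$, and let $u\in W^{1,p}(B_1)$ be a weak solution of the Dirichlet problem $$\sum_{i=1}^N\partial_i\left(|\partial_i u|^{p-2}\partial_i u\right)=(p-1)f\ \text{ in } B_1,\qquad u=v\ \text{ on }\partial B_1,$$ that is, $$-\int_{B_1}\sum_{i=1}^N|\partial_iu|^{p-2}\partial_iu\,\partial_i\varphi\,dx=(p-1)\int_{B_1}f\varphi\,dx\quad\text{for all }\varphi\in C_c^\infty(B_1),$$ and the trace of $u$ on $\partial B_1$ is $v$. Then $$|u|_{L^\infty(B_1)}\le C\left(|f|_{L^\infty(B_1)}^{\frac1{p-1}}+|v|_{L^\infty(\partial B_1)}\right).$$ -/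

import Mathlib

open MeasureTheory Filter Topology Metric
open scoped ENNReal NNReal ContDiff

noncomputable section

namespace PseudoPLaplace

/-- `ℝ^N` with its Euclidean norm. -/
abbrev E (N : ℕ) : Type := EuclideanSpace ℝ (Fin N)

/-- The open unit ball `B_1` of `ℝ^N`. -/
abbrev unitBall (N : ℕ) : Set (E N) := ball (0 : E N) 1

/-- The unit sphere `∂B_1`, as a type. -/
abbrev UnitSphere (N : ℕ) : Type := sphere (0 : E N) 1

/-- Lebesgue measure on `B_1`. -/
abbrev ballMeasure (N : ℕ) : Measure (E N) := volume.restrict (unitBall N)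

/-- The surface measure on `∂B_1`; the measure of `A` is `N` times the volume of the cone
`{t • x | 0 < t < 1, x ∈ A}`. -/
abbrev surfaceMeasure (N : ℕ) : Measure (UnitSphere N) := (volume : Measure (E N)).toSphere

/-- The classical partial derivative `∂_i φ`. -/
def partialDeriv {N : ℕ} (i : Fin N) (φ : E N → ℝ) (x : E N) : ℝ :=
  fderiv ℝ φ x (EuclideanSpace.single i 1)

/-- `φ ∈ 𝓓(Ω)`: smooth, with compact support contained in `Ω`. -/
structure IsTestFunction {N : ℕ} (Ω : Set (E N)) (φ : E N → ℝ) : Prop where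
  smooth : ContDiff ℝ ∞ φ
  hasCompactSupport : HasCompactSupport φ
  tsupport_subset : tsupport φ ⊆ Ω

/-- `g` is the weak (distributional) partial derivative `∂_i u` in the open set `Ω`. -/
structure HasWeakPartialDeriv {N : ℕ} (Ω : Set (E N)) (i : Fin N) (u g : E N → ℝ) : Prop where
  locallyIntegrableOn : LocallyIntegrableOn u Ω
  locallyIntegrableOn_deriv : LocallyIntegrableOn g Ω
  integral_eq : ∀ φ : E N → ℝ, IsTestFunction Ω φ →
    ∫ x in Ω, u x * partialDeriv i φ x = - ∫ x in Ω, g x * φ x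

/-- `u ∈ W^{1,p}(Ω)`, with weak partial derivatives `∂_i u = G i`. -/
structure MemW1p {N : ℕ} (p : ℝ) (Ω : Set (E N)) (u : E N → ℝ) (G : Fin N → E N → ℝ) : Prop where
  memLp : MemLp u (ENNReal.ofReal p) (volume.restrict Ω)
  memLp_deriv : ∀ i, MemLp (G i) (ENNReal.ofReal p) (volume.restrict Ω)
  hasWeakPartialDeriv : ∀ i, HasWeakPartialDeriv Ω i u (G i)

/-- The function `u ∈ W^{1,p}(B_1)` with weak gradient `G` has trace `v` on `∂B_1`: the trace
operator is the closure of the restriction map on functions smooth up to the boundary, so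
there are smooth `w k` with `w k → u` in `W^{1,p}(B_1)` and `w k → v` in `L^p(∂B_1)`. -/
def HasTrace {N : ℕ} (p : ℝ) (u : E N → ℝ) (G : Fin N → E N → ℝ) (v : UnitSphere N → ℝ) : Prop :=
  ∃ w : ℕ → E N → ℝ, (∀ k, ContDiff ℝ ∞ (w k)) ∧
    Tendsto (fun k => eLpNorm (fun x => w k x - u x) (ENNReal.ofReal p) (ballMeasure N))
      atTop (𝓝 0) ∧
    (∀ i, Tendsto
      (fun k => eLpNorm (fun x => partialDeriv i (w k) x - G i x) (ENNReal.ofReal p)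
        (ballMeasure N)) atTop (𝓝 0)) ∧
    Tendsto
      (fun k => eLpNorm (fun y : UnitSphere N => w k (y : E N) - v y) (ENNReal.ofReal p)
        (surfaceMeasure N)) atTop (𝓝 0)

/-- `v ∈ W^{s,p}(∂B_1)` for `0 < s < 1`: `v ∈ L^p(∂B_1)` and the Gagliardo seminorm
`∬ |v(x) - v(y)|^p / |x - y|^{(N-1) + s p} dσ(x) dσ(y)` is finite. -/
def MemFractionalSobolevSphere {N : ℕ} (s p : ℝ) (v : UnitSphere N → ℝ) : Prop :=
  MemLp v (ENNReal.ofReal p) (surfaceMeasure N) ∧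
    ∫⁻ x, ∫⁻ y, ‖v x - v y‖ₑ ^ p / edist x y ^ ((N : ℝ) - 1 + s * p)
      ∂(surfaceMeasure N) ∂(surfaceMeasure N) < ⊤

/-- `u` is a weak solution in `W^{1,p}(B_1)` of
`∑_i ∂_i (|∂_i u|^{p-2} ∂_i u) = (p-1) f` in `B_1`, `u = v` on `∂B_1`:
the equation holds in the sense of distributions, the boundary condition in that of traces. -/
def IsWeakDirichletSolution {N : ℕ} (p : ℝ) (f : E N → ℝ) (v : UnitSphere N → ℝ)
    (u : E N → ℝ) : Prop :=
  ∃ G : Fin N → E N → ℝ, MemW1p p (unitBall N) u G ∧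
    (∀ φ : E N → ℝ, IsTestFunction (unitBall N) φ →
      - ∫ x in unitBall N, ∑ i, |G i x| ^ (p - 2) * G i x * partialDeriv i φ x =
        ∫ x in unitBall N, (p - 1) * f x * φ x) ∧
    HasTrace p u G v

end PseudoPLaplace

end

namespace PseudoPLaplace

open Real (smoothTransition)

/-! The bound comes from comparison with an explicit barrier. The operator is odd, so an upper bound
for `u` and the same bound for `-u` suffice. If `f ≥ -F`, `v ≤ M` and `F' > F`, put `b = M + A (e -
exp x_i₀)` with `A = e F' ^ (1/(p-1))`. Then `b ≥ M` on the sphere, and the operator sends `b` to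
`-(p-1) A ^ (p-1) exp ((p-1) x_i₀) ≤ -(p-1) F'`. So the difference of the fluxes of `u` and `b` has
divergence at least `ε = (p-1)(F' - F) > 0`, while `z = u - b` has trace `≤ 0`. Comparison gives `u
≤ b ≤ M + e² F' ^ (1/(p-1))`, and `F'` decreases to `F`.

The comparison principle is `ae_nonpos_of_strict_subsolution`. Formally, one tests with `Φ(z)`,
where `Φ = smoothTransition` is bounded, nondecreasing and positive exactly on `(0, ∞)`.
Monotonicity of the flux then gives `ε ∫ Φ(z) ≤ 0`. Because `ε > 0`, neither strict monotonicity nor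
a Poincaré inequality is needed.

To make this rigorous, `z` is replaced by the smooth approximants `ζ k` that define the trace, and
`Φ(ζ k)` is multiplied by a cutoff whose gradient is at most `c/d` and lives in a shell of width `d`
(`lintegral_cutoff_le`). The cutoff costs `c/d` times the `L^{p'}` norm of the flux difference and
the `L^p` norm of `Φ(ζ k)`, both over the shell. By `eLpNorm_shell_le` the second norm is controlled
by `d^{1/p}` times a boundary norm, which vanishes as `k → ∞`, plus `d` times a bounded gradient
norm. Thus `1/d` cancels, and what remains is the flux norm over the shell, which tends to `0` with
`d`. -/

/-! ### Polar coordinates and an `L^p` inequality in thin shells. -/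

theorem lintegral_polarCoord {E : Type*} [NormedAddCommGroup E] [NormedSpace ℝ E]
    [MeasurableSpace E] [BorelSpace E] [FiniteDimensional ℝ E] [Nontrivial E]
    (μ : Measure E) [μ.IsAddHaarMeasure] {F : E → ℝ≥0∞} (hF : Measurable F) :
    ∫⁻ x, F x ∂μ = ∫⁻ θ : sphere (0 : E) 1, (∫⁻ r in Set.Ioi (0 : ℝ),
      ENNReal.ofReal (r ^ (Module.finrank ℝ E - 1)) * F (r • (θ : E))) ∂μ.toSphere := by
  have hmp := μ.measurePreserving_homeomorphUnitSphereProd.symm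
    (homeomorphUnitSphereProd E).toMeasurableEquiv
  have h1 : ∫⁻ x, F x ∂μ = ∫⁻ x : ({(0 : E)}ᶜ : Set E), F x ∂(μ.comap (↑)) := by
    rw [lintegral_subtype_comap (measurableSet_singleton _).compl, restrict_compl_singleton]
  have hm : Measurable fun x : ({(0 : E)}ᶜ : Set E) => F x := hF.comp measurable_subtype_coe
  rw [h1, ← hmp.lintegral_comp hm, lintegral_prod]
  · refine lintegral_congr fun θ => ?_
    rw [Measure.volumeIoiPow, lintegral_withDensity_eq_lintegral_mul]
    · rw [← lintegral_subtype_comap measurableSet_Ioi]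
      rfl
    · fun_prop
    · exact hm.comp (hmp.measurable.comp measurable_prodMk_left)
  · exact (hm.comp hmp.measurable).aemeasurable

theorem setLIntegral_shell {E : Type*} [NormedAddCommGroup E] [NormedSpace ℝ E]
    [MeasurableSpace E] [BorelSpace E] [FiniteDimensional ℝ E] [Nontrivial E]
    (μ : Measure E) [μ.IsAddHaarMeasure] {F : E → ℝ≥0∞} (hF : Measurable F) {ρ : ℝ} (hρ : 0 ≤ ρ) :
    ∫⁻ x in {x | ρ < ‖x‖ ∧ ‖x‖ < 1}, F x ∂μ =
      ∫⁻ θ : sphere (0 : E) 1, (∫⁻ r in Set.Ioo ρ 1,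
        ENNReal.ofReal (r ^ (Module.finrank ℝ E - 1)) * F (r • (θ : E))) ∂μ.toSphere := by
  have hS : MeasurableSet {x : E | ρ < ‖x‖ ∧ ‖x‖ < 1} :=
    (measurableSet_lt measurable_const measurable_norm).inter
      (measurableSet_lt measurable_norm measurable_const)
  rw [← lintegral_indicator hS, lintegral_polarCoord μ (hF.indicator hS)]
  refine lintegral_congr fun θ => ?_
  rw [← lintegral_indicator measurableSet_Ioo, ← lintegral_indicator measurableSet_Ioi]
  refine lintegral_congr fun r => ?_
  have hθ : ‖(θ : E)‖ = 1 := norm_eq_of_mem_sphere θ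
  by_cases hr : r ∈ Set.Ioo ρ 1
  · have h0 : 0 < r := hρ.trans_lt hr.1
    have : r • (θ : E) ∈ {x : E | ρ < ‖x‖ ∧ ‖x‖ < 1} := by
      simpa [norm_smul, hθ, abs_of_pos h0] using hr
    rw [Set.indicator_of_mem hr, Set.indicator_of_mem (Set.mem_Ioi.2 h0),
      Set.indicator_of_mem this]
  · rw [Set.indicator_of_notMem hr]
    by_cases h0 : 0 < r
    · have : r • (θ : E) ∉ {x : E | ρ < ‖x‖ ∧ ‖x‖ < 1} := by
        simpa [norm_smul, hθ, abs_of_pos h0] using hr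
      rw [Set.indicator_of_mem (Set.mem_Ioi.2 h0), Set.indicator_of_notMem this, mul_zero]
    · rw [Set.indicator_of_notMem (by simpa using h0)]

theorem lintegral_rpow_le_measure_rpow_mul {α : Type*} [MeasurableSpace α] (μ : Measure α)
    {p : ℝ} (hp : 1 < p) {f : α → ℝ≥0∞} (hf : AEMeasurable f μ) :
    (∫⁻ x, f x ∂μ) ^ p ≤ μ Set.univ ^ (p - 1) * ∫⁻ x, f x ^ p ∂μ := by
  have hpq := Real.HolderConjugate.conjExponent hp
  have h := ENNReal.lintegral_mul_le_Lp_mul_Lq μ hpq hf (aemeasurable_const (b := (1 : ℝ≥0∞)))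
  simp only [Pi.mul_apply, mul_one, ENNReal.one_rpow, lintegral_one] at h
  calc (∫⁻ x, f x ∂μ) ^ p
      ≤ ((∫⁻ x, f x ^ p ∂μ) ^ (1 / p) * μ Set.univ ^ (1 / p.conjExponent)) ^ p := by
        gcongr
    _ = _ := by
        have h0 : 0 < p := by linarith
        rw [ENNReal.mul_rpow_of_nonneg _ _ h0.le, ← ENNReal.rpow_mul, ← ENNReal.rpow_mul,
          one_div_mul_cancel h0.ne', ENNReal.rpow_one, mul_comm]
        congr 2
        rw [Real.conjExponent]
        field_simp

/-- A Hardy-type inequality in a thin shell adjacent to the unit sphere. -/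
theorem setLIntegral_shell_rpow_le {E : Type*} [NormedAddCommGroup E] [NormedSpace ℝ E]
    [MeasurableSpace E] [BorelSpace E] [FiniteDimensional ℝ E] [Nontrivial E]
    (μ : Measure E) [μ.IsAddHaarMeasure] {p : ℝ} (hp : 1 < p) {g : E → ℝ} (hg : ContDiff ℝ 1 g)
    {d : ℝ} (hd : 0 ≤ d) (hd' : d ≤ 1 / 2) :
    ∫⁻ x in {x | 1 - d < ‖x‖ ∧ ‖x‖ < 1}, ‖g x‖ₑ ^ p ∂μ ≤
      2 ^ (p - 1) * (ENNReal.ofReal d * ∫⁻ θ : sphere (0 : E) 1, ‖g θ‖ₑ ^ p ∂μ.toSphere +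
        2 ^ (Module.finrank ℝ E - 1) * ENNReal.ofReal d ^ p *
          ∫⁻ x in {x | 1 - d < ‖x‖ ∧ ‖x‖ < 1}, ‖fderiv ℝ g x‖ₑ ^ p ∂μ) := by
  have hp0 : 0 < p := by linarith
  have hgc : Continuous g := hg.continuous
  have hdc : Continuous (fderiv ℝ g) := hg.continuous_fderiv one_ne_zero
  set n := Module.finrank ℝ E - 1
  set I := Set.Ioo (1 - d) (1 : ℝ)
  have hvol : volume I = ENNReal.ofReal d := by simp [I]
  set J : sphere (0 : E) 1 → ℝ≥0∞ := fun θ =>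
    ∫⁻ r in I, ENNReal.ofReal (r ^ n) * ‖fderiv ℝ g (r • (θ : E))‖ₑ ^ p
  rw [setLIntegral_shell μ (by fun_prop) (by linarith),
    setLIntegral_shell μ (by fun_prop) (by linarith)]
  -- Along each ray: the fundamental theorem of calculus from `r` to `1`, then Hölder on an interval
  -- of length `d`. The Jacobian `r ^ n` lies between `2⁻ⁿ` and `1` because `d ≤ 1/2`.
  have key (θ : sphere (0 : E) 1) (r : ℝ) (hr : r ∈ I) :
      ENNReal.ofReal (r ^ n) * ‖g (r • (θ : E))‖ₑ ^ p ≤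
        2 ^ (p - 1) * (‖g θ‖ₑ ^ p + ENNReal.ofReal d ^ (p - 1) * (2 ^ n * J θ)) := by
    have hθ : ‖(θ : E)‖ = 1 := norm_eq_of_mem_sphere θ
    have hr0 : 0 ≤ r := by linarith [hr.1]
    have hr1 : ENNReal.ofReal (r ^ n) ≤ 1 := by
      rw [ENNReal.ofReal_le_one]; exact pow_le_one₀ hr0 hr.2.le
    have hderiv (s : ℝ) : HasDerivAt (fun s : ℝ => g (s • (θ : E)))
        (fderiv ℝ g (s • (θ : E)) θ) s := by
      have h1 := (hg.differentiable one_ne_zero (s • (θ : E))).hasFDerivAt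
      have h2 : HasDerivAt (fun s : ℝ => s • (θ : E)) ((1 : ℝ) • (θ : E)) s :=
        (hasDerivAt_id s).smul_const _
      have h3 := h1.comp_hasDerivAt s h2
      rw [one_smul] at h3
      exact h3
    have h1 : ‖g (r • (θ : E))‖ₑ ≤ ‖g θ‖ₑ + ∫⁻ s in I, ‖fderiv ℝ g (s • (θ : E))‖ₑ := by
      have h := enorm_sub_le_lintegral_deriv_of_contDiffOn_Icc (a := r) (b := 1)
        (f := fun s : ℝ => g (s • (θ : E))) (by fun_prop) hr.2.le
      have h' : ‖g (r • (θ : E))‖ₑ ≤ ‖g θ‖ₑ + ‖g ((1 : ℝ) • (θ : E)) - g (r • (θ : E))‖ₑ := by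
        rw [one_smul]
        calc ‖g (r • (θ : E))‖ₑ = ‖g θ - (g θ - g (r • (θ : E)))‖ₑ := by congr 1; ring
          _ ≤ _ := enorm_sub_le
      refine h'.trans (add_le_add_right (h.trans ?_) _)
      have hsub : Set.Icc r 1 ⊆ Set.Ioc (1 - d) 1 := fun s hs => ⟨hr.1.trans_le hs.1, hs.2⟩
      refine (lintegral_mono_set hsub).trans ?_
      rw [← setLIntegral_congr (Ioo_ae_eq_Ioc (a := 1 - d) (b := (1 : ℝ)))]
      refine lintegral_mono fun s => ?_
      rw [(hderiv s).deriv]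
      have := (fderiv ℝ g (s • (θ : E))).le_opENorm θ
      rwa [← ofReal_norm (θ : E), hθ, ENNReal.ofReal_one, mul_one] at this
    have h2 : (∫⁻ s in I, ‖fderiv ℝ g (s • (θ : E))‖ₑ) ^ p ≤
        ENNReal.ofReal d ^ (p - 1) * (2 ^ n * J θ) := by
      have h := lintegral_rpow_le_measure_rpow_mul (volume.restrict I) hp
        (f := fun s : ℝ => ‖fderiv ℝ g (s • (θ : E))‖ₑ) (by fun_prop)
      rw [Measure.restrict_apply_univ, hvol] at h
      refine h.trans ?_
      gcongr
      simp only [J]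
      rw [← lintegral_const_mul _ (by fun_prop)]
      refine setLIntegral_mono' measurableSet_Ioo fun s hs => ?_
      have hs2 : (1 : ℝ≥0∞) ≤ 2 ^ n * ENNReal.ofReal (s ^ n) := by
        have : (1 : ℝ) ≤ 2 ^ n * s ^ n := by
          rw [← mul_pow]; exact one_le_pow₀ (by linarith [hs.1])
        calc (1 : ℝ≥0∞) = ENNReal.ofReal 1 := by simp
          _ ≤ ENNReal.ofReal (2 ^ n * s ^ n) := ENNReal.ofReal_le_ofReal this
          _ = _ := by
            rw [ENNReal.ofReal_mul (by positivity), ENNReal.ofReal_pow (by norm_num)]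
            simp
      rw [← mul_assoc]
      exact le_mul_of_one_le_left zero_le hs2
    calc ENNReal.ofReal (r ^ n) * ‖g (r • (θ : E))‖ₑ ^ p
        ≤ 1 * (‖g θ‖ₑ + ∫⁻ s in I, ‖fderiv ℝ g (s • (θ : E))‖ₑ) ^ p := by gcongr
      _ ≤ 2 ^ (p - 1) * (‖g θ‖ₑ ^ p + (∫⁻ s in I, ‖fderiv ℝ g (s • (θ : E))‖ₑ) ^ p) := by
        rw [one_mul]; exact ENNReal.rpow_add_le_mul_rpow_add_rpow _ _ hp.le
      _ ≤ _ := by gcongr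
  have hJ : Measurable J := by
    apply Measurable.lintegral_prod_right
    fun_prop
  have hgm : Measurable fun θ : sphere (0 : E) 1 => ‖g θ‖ₑ ^ p :=
    (hgc.comp continuous_subtype_val).measurable.enorm.pow_const p
  calc _ ≤ ∫⁻ θ : sphere (0 : E) 1, 2 ^ (p - 1) * (ENNReal.ofReal d * ‖g θ‖ₑ ^ p +
            2 ^ n * ENNReal.ofReal d ^ p * J θ) ∂μ.toSphere := by
        refine lintegral_mono fun θ => ?_
        refine (setLIntegral_mono' measurableSet_Ioo (key θ)).trans ?_
        rw [setLIntegral_const, hvol]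
        -- Integrating the constant bound over `I` supplies the missing factor `d`; `d = 0` is
        -- separate because adding exponents needs a nonzero base.
        have hdp : ENNReal.ofReal d ^ p = ENNReal.ofReal d ^ (p - 1) * ENNReal.ofReal d := by
          rcases hd.eq_or_lt with rfl | hd0
          · simp [hp0]
          · nth_rewrite 3 [← ENNReal.rpow_one (ENNReal.ofReal d)]
            rw [← ENNReal.rpow_add _ _ (by simpa using hd0) ENNReal.ofReal_ne_top,
              sub_add_cancel]
        rw [hdp]
        exact le_of_eq (by ring)
    _ = _ := by
        have hm : Measurable fun θ : sphere (0 : E) 1 => ENNReal.ofReal d * ‖g θ‖ₑ ^ p +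
            2 ^ n * ENNReal.ofReal d ^ p * J θ := (hgm.const_mul _).add (hJ.const_mul _)
        rw [lintegral_const_mul _ hm, lintegral_add_left (hgm.const_mul _),
          lintegral_const_mul _ hgm, lintegral_const_mul _ hJ]

/-- The `p`-th root of the preceding inequality, split by subadditivity of `t ↦ t ^ (1/p)`. The
constant is uniform in `g` and `d`, and the gradient term carries the full power of `d` that absorbs
the `1/d` of the cutoff. -/
theorem eLpNorm_shell_le {E : Type*} [NormedAddCommGroup E] [NormedSpace ℝ E]
    [MeasurableSpace E] [BorelSpace E] [FiniteDimensional ℝ E] [Nontrivial E]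
    (μ : Measure E) [μ.IsAddHaarMeasure] {p : ℝ} (hp : 1 < p) :
    ∃ c : ℝ≥0, ∀ g : E → ℝ, ContDiff ℝ 1 g → ∀ d : ℝ, 0 ≤ d → d ≤ 1 / 2 →
      eLpNorm g (ENNReal.ofReal p) (μ.restrict {x | 1 - d < ‖x‖ ∧ ‖x‖ < 1}) ≤
        c * (ENNReal.ofReal d ^ (1 / p) *
            eLpNorm (fun θ : sphere (0 : E) 1 => g θ) (ENNReal.ofReal p) μ.toSphere +
          ENNReal.ofReal d * eLpNorm (fderiv ℝ g) (ENNReal.ofReal p)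
            (μ.restrict {x | 1 - d < ‖x‖ ∧ ‖x‖ < 1})) := by
  have hp0 : 0 < p := by linarith
  have hq0 : 0 < 1 / p := by positivity
  set n := Module.finrank ℝ E - 1
  have hc1 : (2 : ℝ≥0∞) ^ (p - 1) ≠ ⊤ := ENNReal.rpow_ne_top_of_nonneg (by linarith) (by simp)
  have hc2 : (2 : ℝ≥0∞) ^ n ≠ ⊤ := ENNReal.pow_ne_top (by simp)
  set b : ℝ≥0∞ := 2 ^ (p - 1) * 2 ^ n
  have hb : b ^ (1 / p) ≠ ⊤ := ENNReal.rpow_ne_top_of_nonneg hq0.le (ENNReal.mul_ne_top hc1 hc2)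
  refine ⟨(b ^ (1 / p)).toNNReal, fun g hg d hd hd' => ?_⟩
  rw [ENNReal.coe_toNNReal hb]
  have hp1 : ENNReal.ofReal p ≠ 0 := by simpa using hp0
  simp only [eLpNorm_eq_lintegral_rpow_enorm_toReal hp1 ENNReal.ofReal_ne_top,
    ENNReal.toReal_ofReal hp0.le]
  have h := setLIntegral_shell_rpow_le μ hp hg hd hd'
  set A := ∫⁻ θ : sphere (0 : E) 1, ‖g θ‖ₑ ^ p ∂μ.toSphere
  set B := ∫⁻ x in {x | 1 - d < ‖x‖ ∧ ‖x‖ < 1}, ‖fderiv ℝ g x‖ₑ ^ p ∂μ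
  have h2 : 2 ^ (p - 1) * (ENNReal.ofReal d * A + 2 ^ n * ENNReal.ofReal d ^ p * B) ≤
      b * (ENNReal.ofReal d * A + ENNReal.ofReal d ^ p * B) := by
    simp only [b, mul_assoc]
    gcongr
    rw [mul_add]
    have h1 : (1 : ℝ≥0∞) ≤ 2 ^ n := one_le_pow₀ (by norm_num)
    exact add_le_add_left (le_mul_of_one_le_left zero_le h1) _
  refine (ENNReal.rpow_le_rpow (h.trans h2) hq0.le).trans ?_
  rw [ENNReal.mul_rpow_of_nonneg _ _ hq0.le]
  gcongr
  refine (ENNReal.rpow_add_le_add_rpow _ _ hq0.le (by rw [div_le_one hp0]; exact hp.le)).trans ?_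
  rw [ENNReal.mul_rpow_of_nonneg _ _ hq0.le, ENNReal.mul_rpow_of_nonneg _ _ hq0.le,
    ← ENNReal.rpow_mul, mul_one_div_cancel hp0.ne', ENNReal.rpow_one]

/-! ### The truncation `smoothTransition`: Lipschitz bounds and chain rule. -/

theorem deriv_smoothTransition_nonneg (t : ℝ) : 0 ≤ deriv smoothTransition t :=
  Real.smoothTransition.monotone.deriv_nonneg

/-- On `[0, 1]` this is compactness; elsewhere the function sits at a global extremum, so its
derivative vanishes. -/
theorem exists_deriv_smoothTransition_le :
    ∃ K : ℝ≥0, ∀ t, deriv smoothTransition t ≤ K := by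
  have hc : Continuous (deriv smoothTransition) :=
    (Real.smoothTransition.contDiff (n := 1)).continuous_deriv le_rfl
  obtain ⟨K, hK⟩ := (isCompact_Icc (a := (0 : ℝ)) (b := 1)).exists_bound_of_continuousOn
    hc.continuousOn
  refine ⟨K.toNNReal, fun t => ?_⟩
  have hK' : K ≤ K.toNNReal := Real.le_coe_toNNReal K
  by_cases h : t ∈ Set.Icc (0 : ℝ) 1
  · exact (le_abs_self _).trans ((hK t h).trans hK')
  · suffices deriv smoothTransition t = 0 by rw [this]; positivity
    rw [Set.mem_Icc, not_and_or, not_le, not_le] at h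
    rcases h with h | h
    · apply IsLocalMin.deriv_eq_zero
      refine Filter.Eventually.of_forall fun s => ?_
      rw [Real.smoothTransition.zero_of_nonpos h.le]
      exact Real.smoothTransition.nonneg s
    · apply IsLocalMax.deriv_eq_zero
      refine Filter.Eventually.of_forall fun s => ?_
      rw [Real.smoothTransition.one_of_one_le h.le]
      exact Real.smoothTransition.le_one s

theorem abs_smoothTransition_sub_le {K : ℝ≥0} (hK : ∀ t, deriv smoothTransition t ≤ K)
    (a b : ℝ) : |smoothTransition a - smoothTransition b| ≤ K * |a - b| := by
  have h : LipschitzWith K smoothTransition :=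
    lipschitzWith_of_nnnorm_deriv_le
      ((Real.smoothTransition.contDiff (n := 1)).differentiable one_ne_zero) fun t => by
        rw [← NNReal.coe_le_coe, coe_nnnorm, Real.norm_eq_abs,
          abs_of_nonneg (deriv_smoothTransition_nonneg t)]
        exact hK t
  exact h.dist_le_mul a b

/-- Makes the boundary term depend only on the positive part of the approximants, the only part that
is known to vanish in the limit. -/
theorem smoothTransition_le_mul_max {K : ℝ≥0} (hK : ∀ t, deriv smoothTransition t ≤ K)
    (t : ℝ) : smoothTransition t ≤ K * max t 0 := by
  rcases le_total t 0 with h | h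
  · simp [Real.smoothTransition.zero_of_nonpos h, h]
  · have := abs_smoothTransition_sub_le hK t 0
    rw [Real.smoothTransition.zero, sub_zero, sub_zero, abs_of_nonneg h,
      abs_of_nonneg (Real.smoothTransition.nonneg t)] at this
    rwa [max_eq_left h]

theorem hasFDerivAt_smoothTransition_comp {F : Type*} [NormedAddCommGroup F] [NormedSpace ℝ F]
    {g : F → ℝ} {x : F} (hg : DifferentiableAt ℝ g x) :
    HasFDerivAt (fun y => smoothTransition (g y))
      (deriv smoothTransition (g x) • fderiv ℝ g x) x :=
  ((Real.smoothTransition.contDiff (n := 1)).differentiable one_ne_zero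
    (g x)).hasDerivAt.comp_hasFDerivAt x hg.hasFDerivAt

/-! ### Partial derivatives and cutoff functions. -/

theorem abs_partialDeriv_le {N : ℕ} (i : Fin N) (φ : E N → ℝ) (x : E N) :
    |partialDeriv i φ x| ≤ ‖fderiv ℝ φ x‖ := by
  have := (fderiv ℝ φ x).le_opNorm (EuclideanSpace.single i 1)
  simpa [partialDeriv] using this

theorem enorm_fderiv_le_sum {N : ℕ} (φ : E N → ℝ) (x : E N) :
    ‖fderiv ℝ φ x‖ₑ ≤ ∑ i, ‖partialDeriv i φ x‖ₑ := by
  have h : ‖fderiv ℝ φ x‖ ≤ ∑ i, ‖partialDeriv i φ x‖ := by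
    refine ContinuousLinearMap.opNorm_le_bound _ (by positivity) fun y => ?_
    have hy : y = ∑ i, y i • EuclideanSpace.single i (1 : ℝ) := by
      ext j
      simp [Finset.sum_apply, Pi.single_apply]
    conv_lhs => rw [hy]
    rw [map_sum, Finset.sum_mul]
    refine (norm_sum_le _ _).trans (Finset.sum_le_sum fun i _ => ?_)
    rw [map_smul, norm_smul, mul_comm]
    gcongr
    · rfl
    · exact PiLp.norm_apply_le y i
  rw [← ofReal_norm]
  refine (ENNReal.ofReal_le_ofReal h).trans ?_
  rw [ENNReal.ofReal_sum_of_nonneg fun _ _ => norm_nonneg _]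
  simp only [ofReal_norm]
  rfl

/-- A smooth cutoff function that equals `1` except in a thin shell adjacent to the sphere. -/
theorem exists_cutoff (N : ℕ) : ∃ c : ℝ≥0, ∀ d : ℝ, 0 < d → ∃ η : E N → ℝ,
    IsTestFunction (unitBall N) η ∧ (∀ x, 0 ≤ η x) ∧ (∀ x, η x ≤ 1) ∧
    (∀ x, ‖x‖ ^ 2 ≤ 1 - d → η x = 1) ∧ (∀ i x, |partialDeriv i η x| ≤ c / d) ∧
    (∀ i x, partialDeriv i η x ≠ 0 → 1 - d < ‖x‖ ∧ ‖x‖ < 1) := by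
  obtain ⟨K, hK⟩ := exists_deriv_smoothTransition_le
  refine ⟨4 * K, fun d hd => ?_⟩
  -- `q ≥ 1` when `‖x‖² ≤ 1 - d` and `q ≤ 0` when `‖x‖² ≥ 1 - d/2`; the squared norm keeps `q`
  -- smooth at the origin.
  set q : E N → ℝ := fun x => 2 * (1 - ‖x‖ ^ 2) / d - 1
  have hq (x : E N) : HasFDerivAt q (-((4 / d) • innerSL ℝ x)) x := by
    have h1 := ((((hasStrictFDerivAt_norm_sq x).hasFDerivAt.const_sub 1).const_mul
      2).mul_const d⁻¹).sub_const 1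
    refine (h1.congr_fderiv ?_).congr_of_eventuallyEq ?_
    · ext y
      simp
      ring
    · exact Filter.Eventually.of_forall fun y => by simp [q, div_eq_mul_inv]
  have hqs : ContDiff ℝ ∞ q := by
    have := contDiff_norm_sq ℝ (E := E N) (n := ∞)
    simp only [q]
    fun_prop
  set η : E N → ℝ := fun x => smoothTransition (q x)
  have hη1 (x : E N) (hx : ‖x‖ ^ 2 ≤ 1 - d) : η x = 1 := by
    apply Real.smoothTransition.one_of_one_le
    have : 2 ≤ 2 * (1 - ‖x‖ ^ 2) / d := by rw [le_div_iff₀ hd]; linarith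
    simp only [q]; linarith
  have hη0 (x : E N) (hx : η x ≠ 0) : ‖x‖ ^ 2 ≤ 1 - d / 2 := by
    by_contra! h
    apply hx
    apply Real.smoothTransition.zero_of_nonpos
    have : 2 * (1 - ‖x‖ ^ 2) / d ≤ 1 := by rw [div_le_one hd]; linarith
    simp only [q]; linarith
  have hsupp : tsupport η ⊆ {x : E N | ‖x‖ ^ 2 ≤ 1 - d / 2} :=
    closure_minimal hη0 (isClosed_le (by fun_prop) continuous_const)
  have hlt {x : E N} (hx : ‖x‖ ^ 2 ≤ 1 - d / 2) : ‖x‖ < 1 := by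
    nlinarith [norm_nonneg x]
  have hsub : tsupport η ⊆ unitBall N := fun x hx => by
    simpa using hlt (hsupp hx)
  have hder (x : E N) : HasFDerivAt η (deriv smoothTransition (q x) • fderiv ℝ q x) x :=
    hasFDerivAt_smoothTransition_comp (hq x).differentiableAt
  -- Outside the shell `η` takes its extreme value `1` or `0`, so its gradient vanishes there. On
  -- the inner side, `‖x‖² ≤ ‖x‖ ≤ 1 - d`.
  have hloc (i : Fin N) (x : E N) (hx : partialDeriv i η x ≠ 0) : 1 - d < ‖x‖ ∧ ‖x‖ < 1 := by
    constructor
    · by_contra! h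
      apply hx
      have h1 : η x = 1 := by
        by_cases h2 : ‖x‖ ≤ 1
        · exact hη1 x (by nlinarith [norm_nonneg x])
        · exact absurd h (by linarith)
      have : fderiv ℝ η x = 0 := IsLocalMax.fderiv_eq_zero <|
        Filter.Eventually.of_forall fun y => by
          rw [h1]; exact Real.smoothTransition.le_one _
      simp [partialDeriv, this]
    · by_contra! h
      apply hx
      have h1 : η x = 0 := by
        by_contra h0
        exact absurd (hlt (hη0 x h0)) (not_lt.2 h)
      have : fderiv ℝ η x = 0 := IsLocalMin.fderiv_eq_zero <|
        Filter.Eventually.of_forall fun y => by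
          rw [h1]; exact Real.smoothTransition.nonneg _
      simp [partialDeriv, this]
  refine ⟨η, ⟨Real.smoothTransition.contDiff.comp hqs, ?_, hsub⟩,
    fun x => Real.smoothTransition.nonneg _, fun x => Real.smoothTransition.le_one _, hη1,
    fun i x => ?_, hloc⟩
  · exact HasCompactSupport.of_support_subset_isCompact (isCompact_closedBall (0 : E N) 1)
      fun x hx => by simpa using (hlt (hη0 x hx)).le
  · by_cases h0 : partialDeriv i η x = 0
    · rw [h0, abs_zero]; positivity
    have hx := (hloc i x h0).2
    refine (abs_partialDeriv_le i η x).trans ?_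
    rw [(hder x).fderiv, (hq x).fderiv, norm_smul, norm_neg, norm_smul, innerSL_apply_norm,
      Real.norm_of_nonneg (deriv_smoothTransition_nonneg _), Real.norm_of_nonneg (by positivity)]
    calc deriv smoothTransition (q x) * (4 / d * ‖x‖) ≤ K * (4 / d * 1) := by
          gcongr; exact hK _
      _ = _ := by push_cast; ring

/-! ### The comparison principle. -/

theorem ofReal_integral_le_lintegral_ofReal {α : Type*} [MeasurableSpace α] {μ : Measure α}
    (f : α → ℝ) : ENNReal.ofReal (∫ x, f x ∂μ) ≤ ∫⁻ x, ENNReal.ofReal (f x) ∂μ := by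
  by_cases hf : Integrable f μ
  · rw [integral_eq_lintegral_pos_part_sub_lintegral_neg_part hf]
    refine (ENNReal.ofReal_le_ofReal (sub_le_self _ ENNReal.toReal_nonneg)).trans ?_
    exact ENNReal.ofReal_toReal_le
  · simp [integral_undef hf]

/-- The open spherical shell `{x | 1 - d < |x| < 1}`. -/
abbrev shell (N : ℕ) (d : ℝ) : Set (E N) := {x | 1 - d < ‖x‖ ∧ ‖x‖ < 1}

theorem measurableSet_shell (N : ℕ) (d : ℝ) : MeasurableSet (shell N d) :=
  (measurableSet_lt measurable_const measurable_norm).inter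
    (measurableSet_lt measurable_norm measurable_const)

theorem shell_subset_unitBall (N : ℕ) (d : ℝ) : shell N d ⊆ unitBall N := fun x hx => by
  simpa using hx.2

theorem continuous_partialDeriv {N : ℕ} {φ : E N → ℝ} (hφ : ContDiff ℝ ∞ φ) (i : Fin N) :
    Continuous (partialDeriv i φ) :=
  (hφ.continuous_fderiv (by simp)).clm_apply continuous_const

/-- The equation tested with `smoothTransition ∘ ζ` times a cutoff function. -/
theorem lintegral_cutoff_le {N : ℕ} {X H : Fin N → E N → ℝ} {h : E N → ℝ} {ε : ℝ}
    (hε : 0 < ε) {K : ℝ≥0} (hK : ∀ t, deriv smoothTransition t ≤ K)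
    (hX : ∀ i, AEStronglyMeasurable (X i) (ballMeasure N))
    (hH : ∀ i, AEStronglyMeasurable (H i) (ballMeasure N))
    (hh : Integrable h (ballMeasure N)) (hεh : ∀ᵐ x ∂ballMeasure N, ε ≤ h x)
    (hXH : ∀ᵐ x ∂ballMeasure N, 0 ≤ ∑ i, X i x * H i x)
    (heq : ∀ φ : E N → ℝ, IsTestFunction (unitBall N) φ →
      (∫ x in unitBall N, ∑ i, X i x * partialDeriv i φ x) + ∫ x in unitBall N, h x * φ x = 0)
    {ζ : E N → ℝ} (hζ : ContDiff ℝ ∞ ζ) {η : E N → ℝ} {c : ℝ} {d : ℝ}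
    (hη : IsTestFunction (unitBall N) η) (hη0 : ∀ x, 0 ≤ η x) (hη1 : ∀ x, η x ≤ 1)
    (hηc : ∀ i x, |partialDeriv i η x| ≤ c)
    (hηs : ∀ i x, partialDeriv i η x ≠ 0 → x ∈ shell N d) :
    ENNReal.ofReal ε * ∫⁻ x in unitBall N, ENNReal.ofReal (smoothTransition (ζ x) * η x) ≤
      K * (∑ i, ∫⁻ x in unitBall N, ‖X i x‖ₑ * ‖partialDeriv i ζ x - H i x‖ₑ) +
      ENNReal.ofReal c *
        ∑ i, ∫⁻ x in shell N d, ‖X i x‖ₑ * ‖smoothTransition (ζ x)‖ₑ := by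
  set Φ := smoothTransition
  set φ : E N → ℝ := fun x => Φ (ζ x) * η x
  have hΦs : ContDiff ℝ ∞ fun x => Φ (ζ x) := Real.smoothTransition.contDiff.comp hζ
  have hφs : ContDiff ℝ ∞ φ := hΦs.mul hη.smooth
  have hφ : IsTestFunction (unitBall N) φ :=
    ⟨hφs, hη.hasCompactSupport.mul_left, (tsupport_mul_subset_right).trans hη.tsupport_subset⟩
  have hφ0 (x : E N) : 0 ≤ φ x := mul_nonneg (Real.smoothTransition.nonneg _) (hη0 x)
  have hφ1 (x : E N) : φ x ≤ 1 :=
    mul_le_one₀ (Real.smoothTransition.le_one _) (hη0 x) (hη1 x)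
  have hφd (i : Fin N) (x : E N) : partialDeriv i φ x =
      deriv Φ (ζ x) * partialDeriv i ζ x * η x + Φ (ζ x) * partialDeriv i η x := by
    have h1 := (hasFDerivAt_smoothTransition_comp (hζ.differentiable (by simp) x)).mul
      (hη.smooth.differentiable (by simp) x).hasFDerivAt
    simp only [partialDeriv]
    rw [show fderiv ℝ φ x = _ from h1.fderiv]
    simp
    ring
  have hφm : AEStronglyMeasurable φ (ballMeasure N) := hφs.continuous.aestronglyMeasurable
  have hφb : ∀ᵐ x ∂ballMeasure N, ‖φ x‖ ≤ 1 := .of_forall fun x => by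
    rw [Real.norm_of_nonneg (hφ0 x)]; exact hφ1 x
  have hhφ : Integrable (fun x => h x * φ x) (ballMeasure N) := hh.mul_bdd hφm hφb
  have hφi : Integrable φ (ballMeasure N) := by
    have : IsFiniteMeasure (ballMeasure N) := ⟨by simp [measure_ball_lt_top]⟩
    exact (integrable_const (1 : ℝ)).mono' hφm hφb
  have h1 : ENNReal.ofReal ε * ∫⁻ x in unitBall N, ENNReal.ofReal (φ x) =
      ENNReal.ofReal (∫ x in unitBall N, ε * φ x) := by
    rw [integral_const_mul, ENNReal.ofReal_mul hε.le,
      ofReal_integral_eq_lintegral_ofReal hφi (.of_forall hφ0)]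
  have h2 : ∫ x in unitBall N, ε * φ x ≤
      ∫ x in unitBall N, -∑ i, X i x * partialDeriv i φ x := by
    rw [integral_neg, neg_eq_of_add_eq_zero_right (heq φ hφ)]
    refine integral_mono_ae (hφi.const_mul ε) hhφ ?_
    filter_upwards [hεh] with x hx
    exact mul_le_mul_of_nonneg_right hx (hφ0 x)
  rw [h1]
  refine (ENNReal.ofReal_le_ofReal h2).trans ((ofReal_integral_le_lintegral_ofReal _).trans ?_)
  have hm1 (i : Fin N) : AEMeasurable
      (fun x => ‖X i x‖ₑ * ‖partialDeriv i ζ x - H i x‖ₑ) (ballMeasure N) :=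
    (hX i).enorm.mul (((continuous_partialDeriv hζ i).aestronglyMeasurable.sub (hH i)).enorm)
  have hm2 (i : Fin N) : AEMeasurable
      (fun x => ‖X i x‖ₑ * ‖Φ (ζ x)‖ₑ) (ballMeasure N) :=
    (hX i).enorm.mul hΦs.continuous.aestronglyMeasurable.enorm
  have hm3 (i : Fin N) : AEMeasurable
      ((shell N d).indicator fun x => ‖X i x‖ₑ * ‖Φ (ζ x)‖ₑ) (ballMeasure N) :=
    (hm2 i).indicator (measurableSet_shell N d)
  calc ∫⁻ x in unitBall N, ENNReal.ofReal (-∑ i, X i x * partialDeriv i φ x)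
      ≤ ∫⁻ x in unitBall N, (K * ∑ i, ‖X i x‖ₑ * ‖partialDeriv i ζ x - H i x‖ₑ +
          ENNReal.ofReal c *
            ∑ i, (shell N d).indicator (fun x => ‖X i x‖ₑ * ‖Φ (ζ x)‖ₑ) x) := by
        refine lintegral_mono_ae ?_
        filter_upwards [hXH] with x hx
        set D := deriv Φ (ζ x)
        have hD0 : 0 ≤ D := deriv_smoothTransition_nonneg _
        have hDη : D * η x ≤ K := by
          calc D * η x ≤ D * 1 := by gcongr; exact hη1 x
            _ ≤ K := by rw [mul_one]; exact hK _
        -- The first term has a sign by monotonicity and is dropped; the second is the error of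
        -- replacing `H` by the gradient of `ζ`; the third comes from the cutoff.
        have hsplit : -∑ i, X i x * partialDeriv i φ x =
            -(D * η x * ∑ i, X i x * H i x) +
            (∑ i, -(D * η x * (X i x * (partialDeriv i ζ x - H i x))) +
             ∑ i, -(X i x * Φ (ζ x) * partialDeriv i η x)) := by
          rw [Finset.mul_sum, ← Finset.sum_neg_distrib, ← Finset.sum_neg_distrib,
            ← Finset.sum_add_distrib, ← Finset.sum_add_distrib]
          refine Finset.sum_congr rfl fun i _ => ?_
          rw [hφd]
          ring
        have hle : -∑ i, X i x * partialDeriv i φ x ≤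
            K * ∑ i, |X i x| * |partialDeriv i ζ x - H i x| +
              c * ∑ i, (shell N d).indicator (fun x => |X i x| * |Φ (ζ x)|) x := by
          rw [hsplit]
          have hn : 0 ≤ D * η x * ∑ i, X i x * H i x := mul_nonneg (mul_nonneg hD0 (hη0 x)) hx
          have s1 : ∑ i, -(D * η x * (X i x * (partialDeriv i ζ x - H i x))) ≤
              K * ∑ i, |X i x| * |partialDeriv i ζ x - H i x| := by
            rw [Finset.mul_sum]
            refine Finset.sum_le_sum fun i _ => ?_
            refine (neg_le_abs _).trans ?_
            rw [abs_mul, abs_mul (X i x), abs_of_nonneg (mul_nonneg hD0 (hη0 x))]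
            gcongr
          have s2 : ∑ i, -(X i x * Φ (ζ x) * partialDeriv i η x) ≤
              c * ∑ i, (shell N d).indicator (fun x => |X i x| * |Φ (ζ x)|) x := by
            rw [Finset.mul_sum]
            refine Finset.sum_le_sum fun i _ => ?_
            by_cases hs : x ∈ shell N d
            · rw [Set.indicator_of_mem hs]
              refine (neg_le_abs _).trans ?_
              rw [abs_mul, abs_mul (X i x), mul_comm]
              gcongr
              exact hηc i x
            · rw [Set.indicator_of_notMem hs, not_not.1 (mt (hηs i x) hs)]
              simp
          linarith
        refine (ENNReal.ofReal_le_ofReal hle).trans ?_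
        refine ENNReal.ofReal_add_le.trans (le_of_eq ?_)
        rw [ENNReal.ofReal_mul (by positivity), ENNReal.ofReal_coe_nnreal,
          ENNReal.ofReal_sum_of_nonneg fun _ _ => by positivity]
        congr 1
        · congr 1
          refine Finset.sum_congr rfl fun i _ => ?_
          rw [ENNReal.ofReal_mul (abs_nonneg _), Real.enorm_eq_ofReal_abs, Real.enorm_eq_ofReal_abs]
        · rw [ENNReal.ofReal_mul' (Finset.sum_nonneg fun i _ =>
            Set.indicator_nonneg (fun x _ => by positivity) x),
            ENNReal.ofReal_sum_of_nonneg fun i _ =>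
              Set.indicator_nonneg (fun x _ => by positivity) x]
          congr 1
          refine Finset.sum_congr rfl fun i _ => ?_
          by_cases hs : x ∈ shell N d
          · rw [Set.indicator_of_mem hs, Set.indicator_of_mem hs, ENNReal.ofReal_mul (abs_nonneg _),
              Real.enorm_eq_ofReal_abs, Real.enorm_eq_ofReal_abs]
          · rw [Set.indicator_of_notMem hs, Set.indicator_of_notMem hs, ENNReal.ofReal_zero]
    _ = _ := by
        rw [lintegral_add_left' ((Finset.aemeasurable_fun_sum _ fun i _ => hm1 i).const_mul _),
          lintegral_const_mul'' _ (Finset.aemeasurable_fun_sum _ fun i _ => hm1 i),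
          lintegral_const_mul'' _ (Finset.aemeasurable_fun_sum _ fun i _ => hm3 i),
          lintegral_finsetSum' _ fun i _ => hm1 i, lintegral_finsetSum' _ fun i _ => hm3 i]
        simp only [lintegral_indicator (measurableSet_shell N d),
          Measure.restrict_restrict (measurableSet_shell N d),
          Set.inter_eq_left.2 (shell_subset_unitBall N d)]

theorem lintegral_enorm_mul_le_eLpNorm_mul_eLpNorm {α : Type*} [MeasurableSpace α]
    {μ : Measure α} {p : ℝ} (hp : 1 < p) {f g : α → ℝ} (hf : AEStronglyMeasurable f μ)
    (hg : AEStronglyMeasurable g μ) :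
    ∫⁻ x, ‖f x‖ₑ * ‖g x‖ₑ ∂μ ≤
      eLpNorm f (ENNReal.ofReal p.conjExponent) μ * eLpNorm g (ENNReal.ofReal p) μ := by
  have hpq := (Real.HolderConjugate.conjExponent hp).symm
  have h1 : ENNReal.ofReal p ≠ 0 := by simpa using hpq.symm.pos
  have h2 : ENNReal.ofReal p.conjExponent ≠ 0 := by simpa using hpq.pos
  rw [eLpNorm_eq_lintegral_rpow_enorm_toReal h1 ENNReal.ofReal_ne_top,
    eLpNorm_eq_lintegral_rpow_enorm_toReal h2 ENNReal.ofReal_ne_top,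
    ENNReal.toReal_ofReal hpq.pos.le, ENNReal.toReal_ofReal hpq.symm.pos.le]
  exact ENNReal.lintegral_mul_le_Lp_mul_Lq μ hpq hf.enorm hg.enorm

instance isFiniteMeasure_ballMeasure (N : ℕ) : IsFiniteMeasure (ballMeasure N) :=
  ⟨by simp [measure_ball_lt_top]⟩

/-- Separating `H` from the approximation error gives a gradient bound that stays finite as `ζ` runs
through the approximants. -/
theorem eLpNorm_fderiv_smoothTransition_comp_le {N : ℕ} {p : ℝ} (hp : 1 < p) {K : ℝ≥0}
    (hK : ∀ t, deriv smoothTransition t ≤ K) {ζ : E N → ℝ} (hζ : ContDiff ℝ ∞ ζ)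
    {H : Fin N → E N → ℝ} (hH : ∀ i, AEStronglyMeasurable (H i) (ballMeasure N)) :
    eLpNorm (fderiv ℝ fun x => smoothTransition (ζ x)) (ENNReal.ofReal p) (ballMeasure N) ≤
      K * ∑ i, (eLpNorm (fun x => partialDeriv i ζ x - H i x) (ENNReal.ofReal p) (ballMeasure N) +
        eLpNorm (H i) (ENNReal.ofReal p) (ballMeasure N)) := by
  have hp1 : 1 ≤ ENNReal.ofReal p := by simpa using hp.le
  have hm (i : Fin N) : AEStronglyMeasurable (partialDeriv i ζ) (ballMeasure N) :=
    (continuous_partialDeriv hζ i).aestronglyMeasurable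
  calc eLpNorm (fderiv ℝ fun x => smoothTransition (ζ x)) (ENNReal.ofReal p) (ballMeasure N)
      ≤ K * eLpNorm (fun x => ∑ i, ‖partialDeriv i ζ x‖) (ENNReal.ofReal p) (ballMeasure N) := by
        refine eLpNorm_le_nnreal_smul_eLpNorm_of_ae_le_mul (.of_forall fun x => ?_) _
        rw [(hasFDerivAt_smoothTransition_comp (hζ.differentiable (by simp) x)).fderiv, nnnorm_smul]
        gcongr
        · rw [← NNReal.coe_le_coe, coe_nnnorm,
            Real.norm_of_nonneg (deriv_smoothTransition_nonneg _)]
          exact hK _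
        · have h := enorm_fderiv_le_sum ζ x
          have h2 : ∑ i, ‖partialDeriv i ζ x‖ₑ = ‖∑ i, ‖partialDeriv i ζ x‖‖ₑ := by
            rw [← ofReal_norm, Real.norm_of_nonneg (Finset.sum_nonneg fun _ _ => norm_nonneg _),
              ENNReal.ofReal_sum_of_nonneg fun _ _ => norm_nonneg _]
            simp only [ofReal_norm]
          rw [h2] at h
          exact ENNReal.coe_le_coe.1 h
    _ ≤ K * ∑ i, eLpNorm (fun x => ‖partialDeriv i ζ x‖) (ENNReal.ofReal p) (ballMeasure N) := by
        gcongr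
        have := eLpNorm_sum_le (s := Finset.univ) (f := fun i x => ‖partialDeriv i ζ x‖)
          (fun i _ => (hm i).norm) hp1
        simpa only [Finset.sum_fn] using this
    _ ≤ _ := by
        gcongr with i
        rw [eLpNorm_norm]
        calc eLpNorm (partialDeriv i ζ) (ENNReal.ofReal p) (ballMeasure N)
            = eLpNorm ((fun x => partialDeriv i ζ x - H i x) + H i) (ENNReal.ofReal p)
              (ballMeasure N) := by congr 1; ext x; simp
          _ ≤ _ := eLpNorm_add_le ((hm i).sub (hH i)) (hH i) hp1

/-- A function `z` with trace `≤ 0` that satisfies a monotone inequality with a strictly positive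
zeroth-order term is nonpositive. -/
theorem ae_nonpos_of_strict_subsolution {N : ℕ} [Nonempty (Fin N)] {p : ℝ} (hp : 1 < p)
    {X H : Fin N → E N → ℝ} {h : E N → ℝ} {ε : ℝ} (hε : 0 < ε)
    (hX : ∀ i, MemLp (X i) (ENNReal.ofReal p.conjExponent) (ballMeasure N))
    (hH : ∀ i, MemLp (H i) (ENNReal.ofReal p) (ballMeasure N))
    (hh : Integrable h (ballMeasure N)) (hεh : ∀ᵐ x ∂ballMeasure N, ε ≤ h x)
    (hXH : ∀ᵐ x ∂ballMeasure N, 0 ≤ ∑ i, X i x * H i x)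
    (heq : ∀ φ : E N → ℝ, IsTestFunction (unitBall N) φ →
      (∫ x in unitBall N, ∑ i, X i x * partialDeriv i φ x) + ∫ x in unitBall N, h x * φ x = 0)
    {z : E N → ℝ} (hz : AEStronglyMeasurable z (ballMeasure N))
    {ζ : ℕ → E N → ℝ} (hζ : ∀ k, ContDiff ℝ ∞ (ζ k))
    (hζz : Tendsto (fun k => eLpNorm (fun x => ζ k x - z x) (ENNReal.ofReal p) (ballMeasure N))
      atTop (𝓝 0))
    (hζH : ∀ i, Tendsto (fun k => eLpNorm (fun x => partialDeriv i (ζ k) x - H i x)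
      (ENNReal.ofReal p) (ballMeasure N)) atTop (𝓝 0))
    (hζb : Tendsto (fun k => eLpNorm (fun y : UnitSphere N => max (ζ k y) 0) (ENNReal.ofReal p)
      (surfaceMeasure N)) atTop (𝓝 0)) :
    ∀ᵐ x ∂ballMeasure N, z x ≤ 0 := by
  obtain ⟨K, hK⟩ := exists_deriv_smoothTransition_le
  obtain ⟨c, hc⟩ := exists_cutoff N
  obtain ⟨b, hb⟩ := eLpNorm_shell_le (volume : Measure (E N)) hp
  have hp1 : 1 ≤ ENNReal.ofReal p := by simpa using hp.le
  set q := ENNReal.ofReal p.conjExponent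
  have hq0 : 0 < p.conjExponent := (Real.HolderConjugate.conjExponent hp).symm.pos
  -- Hölder factor for passing from `L^p` to `L^1` on the ball.
  set V : ℝ≥0∞ := ballMeasure N Set.univ ^ (1 / (1 : ℝ≥0∞).toReal - 1 / (ENNReal.ofReal p).toReal)
  have hV : V ≠ ⊤ := by
    refine ENNReal.rpow_ne_top_of_nonneg ?_ (measure_ne_top _ _)
    rw [ENNReal.toReal_ofReal (by linarith), ENNReal.toReal_one, div_one, sub_nonneg,
      div_le_one (by linarith)]
    exact hp.le
  set SH := ∑ i, eLpNorm (H i) (ENNReal.ofReal p) (ballMeasure N)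
  have hSH : SH ≠ ⊤ := (ENNReal.sum_lt_top.2 fun i _ => (hH i).2).ne
  have hshell (d : ℝ) : volume.restrict (shell N d) ≤ ballMeasure N :=
    Measure.restrict_mono (shell_subset_unitBall N d) le_rfl
  set a : ℝ → ℝ≥0∞ := fun d => ∑ i, eLpNorm (X i) q (volume.restrict (shell N d))
  have ha (d : ℝ) : a d ≠ ⊤ :=
    (ENNReal.sum_lt_top.2 fun i _ => ((hX i).mono_measure (hshell d)).2).ne
  -- The limit `k → ∞` is taken with `d` fixed; only then does `d` tend to `0`. The reverse order
  -- would leave `d ^ (1/p) / d` in front of the boundary term.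
  have main (d : ℝ) (hd : 0 < d) (hd' : d ≤ 1 / 2) (η : E N → ℝ)
      (hη : IsTestFunction (unitBall N) η) (hη0 : ∀ x, 0 ≤ η x) (hη1 : ∀ x, η x ≤ 1)
      (hηc : ∀ i x, |partialDeriv i η x| ≤ c / d)
      (hηs : ∀ i x, partialDeriv i η x ≠ 0 → x ∈ shell N d) :
      ENNReal.ofReal ε * ∫⁻ x in unitBall N, ENNReal.ofReal (smoothTransition (z x) * η x) ≤
        (c * b * K * SH) * a d := by
    have bound (k : ℕ) :
        ENNReal.ofReal ε * ∫⁻ x in unitBall N, ENNReal.ofReal (smoothTransition (z x) * η x) ≤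
        ENNReal.ofReal ε * (K * (V *
          eLpNorm (fun x => ζ k x - z x) (ENNReal.ofReal p) (ballMeasure N))) +
        (K * (∑ i, eLpNorm (X i) q (ballMeasure N) *
          eLpNorm (fun x => partialDeriv i (ζ k) x - H i x) (ENNReal.ofReal p) (ballMeasure N)) +
        ENNReal.ofReal (c / d) * (a d * (b * (ENNReal.ofReal d ^ (1 / p) *
          (K * eLpNorm (fun y : UnitSphere N => max (ζ k y) 0) (ENNReal.ofReal p)
            (surfaceMeasure N)) + ENNReal.ofReal d * (K *
          ∑ i, (eLpNorm (fun x => partialDeriv i (ζ k) x - H i x) (ENNReal.ofReal p)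
            (ballMeasure N) + eLpNorm (H i) (ENNReal.ofReal p) (ballMeasure N))))))) := by
      have hζc : Continuous (ζ k) := (hζ k).continuous
      have hΦs : ContDiff ℝ ∞ fun x => smoothTransition (ζ k x) :=
        Real.smoothTransition.contDiff.comp (hζ k)
      have e1 : ∫⁻ x in unitBall N, ENNReal.ofReal (smoothTransition (z x) * η x) ≤
          (∫⁻ x in unitBall N, ENNReal.ofReal (smoothTransition (ζ k x) * η x)) + K * (V *
          eLpNorm (fun x => ζ k x - z x) (ENNReal.ofReal p) (ballMeasure N)) := by
        have hm : AEStronglyMeasurable (fun x => ζ k x - z x) (ballMeasure N) :=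
          hζc.aestronglyMeasurable.sub hz
        have h1 : ∫⁻ x in unitBall N, ‖ζ k x - z x‖ₑ ≤
            V * eLpNorm (fun x => ζ k x - z x) (ENNReal.ofReal p) (ballMeasure N) := by
          rw [← eLpNorm_one_eq_lintegral_enorm, mul_comm]
          exact eLpNorm_le_eLpNorm_mul_rpow_measure_univ hp1 hm
        refine le_trans ?_ (add_le_add_right (mul_le_mul_right h1 _) _)
        rw [← lintegral_const_mul'' _ hm.enorm, ← lintegral_add_right' _ (hm.enorm.const_mul _)]
        refine lintegral_mono fun x => ?_
        have : smoothTransition (z x) * η x ≤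
            smoothTransition (ζ k x) * η x + K * |ζ k x - z x| := by
          have h2 := abs_smoothTransition_sub_le hK (z x) (ζ k x)
          rw [abs_sub_comm (z x)] at h2
          have h3 := (le_abs_self _).trans h2
          have h4 : 0 ≤ K * |ζ k x - z x| := by positivity
          nlinarith [hη0 x, hη1 x]
        refine (ENNReal.ofReal_le_ofReal this).trans (ENNReal.ofReal_add_le.trans ?_)
        rw [ENNReal.ofReal_mul K.coe_nonneg, ENNReal.ofReal_coe_nnreal,
          ← Real.enorm_eq_ofReal_abs]
      have e2 := lintegral_cutoff_le hε hK (fun i => (hX i).1) (fun i => (hH i).1) hh hεh hXH heq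
        (hζ k) hη hη0 hη1 hηc hηs
      have e3 : eLpNorm (fun x => smoothTransition (ζ k x)) (ENNReal.ofReal p)
          (volume.restrict (shell N d)) ≤ b * (ENNReal.ofReal d ^ (1 / p) *
          (K * eLpNorm (fun y : UnitSphere N => max (ζ k y) 0) (ENNReal.ofReal p)
            (surfaceMeasure N)) + ENNReal.ofReal d * (K *
          ∑ i, (eLpNorm (fun x => partialDeriv i (ζ k) x - H i x) (ENNReal.ofReal p)
            (ballMeasure N) + eLpNorm (H i) (ENNReal.ofReal p) (ballMeasure N)))) := by
        refine (hb _ (hΦs.of_le (by simp)) d hd.le hd').trans ?_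
        gcongr
        · refine eLpNorm_le_nnreal_smul_eLpNorm_of_ae_le_mul (.of_forall fun y => ?_) _
          rw [← NNReal.coe_le_coe, NNReal.coe_mul, coe_nnnorm, coe_nnnorm,
            Real.norm_of_nonneg (Real.smoothTransition.nonneg _),
            Real.norm_of_nonneg (le_max_right _ _)]
          exact smoothTransition_le_mul_max hK _
        · exact (eLpNorm_mono_measure _ (hshell d)).trans
            (eLpNorm_fderiv_smoothTransition_comp_le hp hK (hζ k) fun i => (hH i).1)
      calc _ ≤ ENNReal.ofReal ε *
            ((∫⁻ x in unitBall N, ENNReal.ofReal (smoothTransition (ζ k x) * η x)) + K * (V *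
              eLpNorm (fun x => ζ k x - z x) (ENNReal.ofReal p) (ballMeasure N))) := by gcongr
        _ = ENNReal.ofReal ε * (K * (V *
              eLpNorm (fun x => ζ k x - z x) (ENNReal.ofReal p) (ballMeasure N))) +
            ENNReal.ofReal ε *
            ∫⁻ x in unitBall N, ENNReal.ofReal (smoothTransition (ζ k x) * η x) := by
          rw [mul_add, add_comm]
        _ ≤ _ := by
          refine add_le_add_right (e2.trans ?_) _
          gcongr with i
          · exact lintegral_enorm_mul_le_eLpNorm_mul_eLpNorm hp (hX i).1
              ((continuous_partialDeriv (hζ k) i).aestronglyMeasurable.sub (hH i).1)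
          · rw [Finset.sum_mul]
            refine Finset.sum_le_sum fun i _ => ?_
            refine (lintegral_enorm_mul_le_eLpNorm_mul_eLpNorm hp
              ((hX i).mono_measure (hshell d)).1 hΦs.continuous.aestronglyMeasurable).trans ?_
            gcongr
    have lim := ge_of_tendsto' (b := ENNReal.ofReal ε *
      ∫⁻ x in unitBall N, ENNReal.ofReal (smoothTransition (z x) * η x)) (x := atTop)
      (a := ENNReal.ofReal ε * (K * (V * 0)) +
        (K * (∑ i, eLpNorm (X i) q (ballMeasure N) * 0) +
        ENNReal.ofReal (c / d) * (a d * (b * (ENNReal.ofReal d ^ (1 / p) * (K * 0) +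
          ENNReal.ofReal d * (K *
          ∑ i, (0 + eLpNorm (H i) (ENNReal.ofReal p) (ballMeasure N)))))))) ?_ bound
    · refine lim.trans (le_of_eq ?_)
      simp only [mul_zero, Finset.sum_const_zero, zero_add]
      -- The cutoff gradient `c/d` cancels against the shell width `d`.
      have : ENNReal.ofReal (c / d) * ENNReal.ofReal d = c := by
        rw [← ENNReal.ofReal_mul (by positivity), div_mul_cancel₀ _ hd.ne',
          ENNReal.ofReal_coe_nnreal]
      rw [← this]
      ring
    · have hdp : ENNReal.ofReal d ^ (1 / p) ≠ ⊤ :=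
        ENNReal.rpow_ne_top_of_nonneg (by positivity) ENNReal.ofReal_ne_top
      have cm {u : ℕ → ℝ≥0∞} {l : ℝ≥0∞} (r : ℝ≥0∞) (hr : r ≠ ⊤) (hu : Tendsto u atTop (𝓝 l)) :
          Tendsto (fun k => r * u k) atTop (𝓝 (r * l)) :=
        ENNReal.Tendsto.const_mul hu (Or.inr hr)
      refine (cm _ ENNReal.ofReal_ne_top (cm _ ENNReal.coe_ne_top (cm _ hV hζz))).add
        ((cm _ ENNReal.coe_ne_top (tendsto_finsetSum _ fun i _ => cm _ (hX i).2.ne (hζH i))).add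
        (cm _ ENNReal.ofReal_ne_top (cm _ (ha d) (cm _ ENNReal.coe_ne_top
          ((cm _ hdp (cm _ ENNReal.coe_ne_top hζb)).add (cm _ ENNReal.ofReal_ne_top
          (cm _ ENNReal.coe_ne_top (tendsto_finsetSum _ fun i _ =>
            (hζH i).add tendsto_const_nhds))))))))
  -- The shift by `2` ensures `δ n ≤ 1/2`, as the shell inequality requires.
  set δ : ℕ → ℝ := fun n => 1 / ((n : ℝ) + 2)
  have hδ0 (n : ℕ) : 0 < δ n := by positivity
  have hδ1 (n : ℕ) : δ n ≤ 1 / 2 :=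
    one_div_le_one_div_of_le (by norm_num) (by linarith [n.cast_nonneg (α := ℝ)])
  have hδ : Tendsto δ atTop (𝓝 0) :=
    tendsto_const_nhds.div_atTop (tendsto_natCast_atTop_atTop.atTop_add tendsto_const_nhds)
  choose η hη hη0 hη1 hηe hηc hηs using fun n => hc (δ n) (hδ0 n)
  have hshell0 : Tendsto (fun n => ballMeasure N (shell N (δ n))) atTop (𝓝 0) := by
    have hanti : Antitone fun n => shell N (δ n) := fun m n hmn x hx => by
      refine ⟨?_, hx.2⟩
      have : δ n ≤ δ m := one_div_le_one_div_of_le (by positivity) (by simpa using hmn)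
      linarith [hx.1]
    have hempty : ⋂ n, shell N (δ n) = ∅ := by
      refine Set.eq_empty_of_forall_notMem fun x hx => ?_
      rw [Set.mem_iInter] at hx
      have h1 : (1 : ℝ) - 0 ≤ ‖x‖ := le_of_tendsto' (tendsto_const_nhds.sub hδ) fun n => (hx n).1.le
      linarith [(hx 0).2]
    have := tendsto_measure_iInter_atTop (μ := ballMeasure N) (s := fun n => shell N (δ n))
      (fun n => (measurableSet_shell N _).nullMeasurableSet) hanti ⟨0, measure_ne_top _ _⟩
    rwa [hempty, measure_empty] at this
  -- Absolute continuity of the integral of `‖X i‖ ^ q` over shells that shrink to the empty set.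
  have ha0 : Tendsto (fun n => a (δ n)) atTop (𝓝 0) := by
    have : Tendsto (fun n => a (δ n)) atTop (𝓝 (∑ i : Fin N, 0)) := by
      refine tendsto_finsetSum _ fun i _ => ?_
      have hq1 : q ≠ 0 := by simpa [q] using hq0
      have hfin : ∫⁻ x in unitBall N, ‖X i x‖ₑ ^ q.toReal ≠ ⊤ :=
        (lintegral_rpow_enorm_lt_top_of_eLpNorm_lt_top hq1 ENNReal.ofReal_ne_top (hX i).2).ne
      have ht := (ENNReal.continuous_rpow_const (y := 1 / q.toReal)).continuousAt.tendsto.comp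
        (tendsto_setLIntegral_zero hfin hshell0)
      rw [ENNReal.zero_rpow_of_pos (by
        rw [ENNReal.toReal_ofReal hq0.le]; positivity)] at ht
      refine ht.congr fun n => ?_
      rw [eLpNorm_eq_lintegral_rpow_enorm_toReal hq1 ENNReal.ofReal_ne_top]
      simp only [Function.comp_apply, Measure.restrict_restrict (measurableSet_shell N _),
        Set.inter_eq_left.2 (shell_subset_unitBall N _)]
    simpa using this
  have hzm : AEStronglyMeasurable (fun x => smoothTransition (z x)) (ballMeasure N) :=
    Real.smoothTransition.continuous.comp_aestronglyMeasurable hz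
  -- Fatou applies because at each point of the open ball the cutoffs are eventually equal to `1`.
  have hfatou : ∫⁻ x in unitBall N, ENNReal.ofReal (smoothTransition (z x)) ≤
      liminf (fun n => ∫⁻ x in unitBall N, ENNReal.ofReal (smoothTransition (z x) * η n x))
        atTop := by
    refine le_trans (lintegral_mono_ae ?_) (lintegral_liminf_le' fun n =>
      (hzm.mul (hη n).smooth.continuous.aestronglyMeasurable).aemeasurable.ennreal_ofReal)
    filter_upwards [ae_restrict_mem measurableSet_ball] with x hx
    have hx1 : ‖x‖ < 1 := by simpa using hx
    have hev : ∀ᶠ n in atTop, δ n < 1 - ‖x‖ ^ 2 :=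
      hδ.eventually_lt_const (by nlinarith [norm_nonneg x])
    refine le_of_eq (Tendsto.liminf_eq ?_).symm
    refine tendsto_const_nhds.congr' ?_
    filter_upwards [hev] with n hn
    rw [hηe n x (by linarith), mul_one]
  have hlim0 : Tendsto (fun n => ENNReal.ofReal ε *
      ∫⁻ x in unitBall N, ENNReal.ofReal (smoothTransition (z x) * η n x)) atTop (𝓝 0) := by
    have hC : (c * b * K * SH : ℝ≥0∞) ≠ ⊤ := by finiteness
    have := ENNReal.Tendsto.const_mul ha0 (Or.inr hC)
    rw [mul_zero] at this
    exact tendsto_of_tendsto_of_tendsto_of_le_of_le tendsto_const_nhds this (fun _ => zero_le)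
      fun n => main (δ n) (hδ0 n) (hδ1 n) (η n) (hη n) (hη0 n) (hη1 n) (hηc n) (hηs n)
  have hε' : ENNReal.ofReal ε ≠ 0 := by simpa using hε
  have hlim1 : Tendsto (fun n =>
      ∫⁻ x in unitBall N, ENNReal.ofReal (smoothTransition (z x) * η n x)) atTop (𝓝 0) := by
    have := ENNReal.Tendsto.const_mul (a := (ENNReal.ofReal ε)⁻¹) hlim0
      (Or.inr (by simpa using hε))
    simpa [← mul_assoc, ENNReal.inv_mul_cancel hε' ENNReal.ofReal_ne_top] using this
  rw [hlim1.liminf_eq, nonpos_iff_eq_zero,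
    lintegral_eq_zero_iff' hzm.aemeasurable.ennreal_ofReal] at hfatou
  filter_upwards [hfatou] with x hx
  simp only [Pi.zero_apply, ENNReal.ofReal_eq_zero] at hx
  by_contra! h0
  exact absurd (Real.smoothTransition.pos_of_pos h0) (not_lt.2 hx)

/-! ### The flux `|t| ^ (p - 2) * t` and integrability against test functions. -/

/-- With `a = |s| ^ r` and `b = |t| ^ r`, twice the product is `(a - b)(s² - t²) + (a + b)(s - t)²`,
and both summands are nonnegative. -/
theorem flux_sub_mul_sub_nonneg {r : ℝ} (hr : 0 ≤ r) (s t : ℝ) :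
    0 ≤ (|s| ^ r * s - |t| ^ r * t) * (s - t) := by
  have h1 : 0 ≤ (|s| ^ r - |t| ^ r) * (s ^ 2 - t ^ 2) := by
    rcases le_total |s| |t| with h | h
    · exact mul_nonneg_of_nonpos_of_nonpos
        (sub_nonpos.2 (Real.rpow_le_rpow (abs_nonneg _) h hr)) (sub_nonpos.2 (sq_le_sq.2 h))
    · exact mul_nonneg
        (sub_nonneg.2 (Real.rpow_le_rpow (abs_nonneg _) h hr)) (sub_nonneg.2 (sq_le_sq.2 h))
  have h2 : 0 ≤ (|s| ^ r + |t| ^ r) * (s - t) ^ 2 := by positivity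
  nlinarith

theorem abs_flux {p : ℝ} (hp : 2 < p) (t : ℝ) : |(|t| ^ (p - 2) * t)| = |t| ^ (p - 1) := by
  rw [abs_mul, abs_of_nonneg (Real.rpow_nonneg (abs_nonneg _) _)]
  rcases eq_or_ne t 0 with rfl | ht
  · rw [abs_zero, mul_zero, Real.zero_rpow (by linarith)]
  · conv_lhs => rw [← Real.rpow_one |t|, ← Real.rpow_mul (abs_nonneg _), one_mul]
    rw [← Real.rpow_add (abs_pos.2 ht)]
    congr 1
    ring

theorem continuous_flux {p : ℝ} (hp : 2 < p) : Continuous fun t : ℝ => |t| ^ (p - 2) * t :=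
  (continuous_abs.rpow_const fun _ => Or.inr (by linarith)).mul continuous_id

/-- The flux has size `|g| ^ (p - 1)`, and `p / (p - 1)` is the conjugate exponent. -/
theorem memLp_flux {α : Type*} [MeasurableSpace α] {μ : Measure α} {p : ℝ} (hp : 2 < p)
    {g : α → ℝ} (hg : MemLp g (ENNReal.ofReal p) μ) :
    MemLp (fun x => |g x| ^ (p - 2) * g x) (ENNReal.ofReal p.conjExponent) μ := by
  have h := hg.norm_rpow_div (ENNReal.ofReal (p - 1))
  rw [← ENNReal.ofReal_div_of_pos (by linarith), ENNReal.toReal_ofReal (by linarith)] at h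
  refine h.mono ((continuous_flux hp).comp_aestronglyMeasurable hg.1) (.of_forall fun x => ?_)
  rw [Real.norm_eq_abs, abs_flux hp, Real.norm_of_nonneg (by positivity), Real.norm_eq_abs]

theorem IsTestFunction.integrable_mul_partialDeriv {N : ℕ} {φ : E N → ℝ}
    (hφ : IsTestFunction (unitBall N) φ) {g : E N → ℝ} (hg : Integrable g (ballMeasure N))
    (i : Fin N) : Integrable (fun x => g x * partialDeriv i φ x) (ballMeasure N) := by
  have hc := continuous_partialDeriv hφ.smooth i
  obtain ⟨b, hb⟩ := (isCompact_closedBall (0 : E N) 1).exists_bound_of_continuousOn hc.continuousOn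
  refine hg.mul_bdd hc.aestronglyMeasurable (c := b) ?_
  filter_upwards [ae_restrict_mem measurableSet_ball] with x hx
  exact hb x (ball_subset_closedBall hx)

theorem IsTestFunction.integrable_mul {N : ℕ} {φ : E N → ℝ}
    (hφ : IsTestFunction (unitBall N) φ) {g : E N → ℝ} (hg : Integrable g (ballMeasure N)) :
    Integrable (fun x => g x * φ x) (ballMeasure N) := by
  have hc := hφ.smooth.continuous
  obtain ⟨b, hb⟩ := (isCompact_closedBall (0 : E N) 1).exists_bound_of_continuousOn hc.continuousOn
  refine hg.mul_bdd hc.aestronglyMeasurable (c := b) ?_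
  filter_upwards [ae_restrict_mem measurableSet_ball] with x hx
  exact hb x (ball_subset_closedBall hx)

/-! ### Exponential functions of one coordinate. -/

theorem hasFDerivAt_exp_coord {N : ℕ} (i : Fin N) (c : ℝ) (x : E N) :
    HasFDerivAt (fun y : E N => Real.exp (c * y i))
      ((Real.exp (c * x i) * c) • (EuclideanSpace.proj i : E N →L[ℝ] ℝ)) x := by
  have h1 : HasFDerivAt (fun y : E N => c * y i)
      (c • (EuclideanSpace.proj i : E N →L[ℝ] ℝ)) x :=
    (EuclideanSpace.proj i : E N →L[ℝ] ℝ).hasFDerivAt.const_mul c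
  refine h1.exp.congr_fderiv ?_
  rw [smul_smul]

theorem contDiff_exp_coord {N : ℕ} (i : Fin N) (c : ℝ) :
    ContDiff ℝ ∞ fun y : E N => Real.exp (c * y i) :=
  (contDiff_const.mul (EuclideanSpace.proj i : E N →L[ℝ] ℝ).contDiff).exp

/-- Integration by parts on the whole space, possible since `φ` is supported in the ball. With `c =
p - 1` it computes the weak divergence of the barrier's flux. -/
theorem integral_exp_coord_mul_partialDeriv {N : ℕ} (i : Fin N) (c : ℝ) {φ : E N → ℝ}
    (hφ : IsTestFunction (unitBall N) φ) :
    ∫ x in unitBall N, Real.exp (c * x i) * partialDeriv i φ x =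
      -(c * ∫ x in unitBall N, Real.exp (c * x i) * φ x) := by
  have hφ0 (x : E N) (hx : x ∉ unitBall N) : φ x = 0 :=
    image_eq_zero_of_notMem_tsupport fun h => hx (hφ.tsupport_subset h)
  have hφd0 (x : E N) (hx : x ∉ unitBall N) : partialDeriv i φ x = 0 := by
    have : fderiv ℝ φ x = 0 := by
      by_contra h
      exact hx (hφ.tsupport_subset (support_fderiv_subset ℝ h))
    simp [partialDeriv, this]
  have hes := contDiff_exp_coord i c (N := N)
  have hpc : HasCompactSupport (partialDeriv i φ) :=
    (hφ.hasCompactSupport.fderiv (𝕜 := ℝ)).comp_left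
      (g := fun L : E N →L[ℝ] ℝ => L (EuclideanSpace.single i 1)) rfl
  have hed (x : E N) : fderiv ℝ (fun y : E N => Real.exp (c * y i)) x
      (EuclideanSpace.single i 1) = c * Real.exp (c * x i) := by
    rw [(hasFDerivAt_exp_coord i c x).fderiv]
    simp [mul_comm]
  rw [setIntegral_eq_integral_of_forall_compl_eq_zero fun x hx => by rw [hφd0 x hx, mul_zero],
    setIntegral_eq_integral_of_forall_compl_eq_zero fun x hx => by rw [hφ0 x hx, mul_zero]]
  have := integral_mul_fderiv_eq_neg_fderiv_mul_of_integrable (μ := (volume : Measure (E N)))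
    (f := fun y : E N => Real.exp (c * y i)) (g := φ) (v := EuclideanSpace.single i 1) ?_ ?_ ?_
    (fun x _ => hes.differentiable (by simp) x) (fun x _ => hφ.smooth.differentiable (by simp) x)
  · refine Eq.trans this ?_
    simp only [hed, mul_assoc, integral_const_mul]
  · simp only [hed]
    exact ((hes.continuous.const_mul c).mul hφ.smooth.continuous).integrable_of_hasCompactSupport
      hφ.hasCompactSupport.mul_left
  · exact (hes.continuous.mul
      (continuous_partialDeriv hφ.smooth i)).integrable_of_hasCompactSupport hpc.mul_left
  · exact (hes.continuous.mul hφ.smooth.continuous).integrable_of_hasCompactSupport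
      hφ.hasCompactSupport.mul_left

/-! ### Odd symmetry, the barrier and the one-sided bound. -/

theorem IsWeakDirichletSolution.neg {N : ℕ} {p : ℝ} {f : E N → ℝ} {v : UnitSphere N → ℝ}
    {u : E N → ℝ} (hu : IsWeakDirichletSolution p f v u) :
    IsWeakDirichletSolution p (fun x => -f x) (fun y => -v y) (fun x => -u x) := by
  obtain ⟨G, hG, heq, w, hws, hwu, hwG, hwv⟩ := hu
  have hneg {α : Type} [MeasurableSpace α] {μ : Measure α} {a b : α → ℝ} :
      eLpNorm (fun x => -a x - -b x) (ENNReal.ofReal p) μ =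
        eLpNorm (fun x => a x - b x) (ENNReal.ofReal p) μ := by
    rw [← eLpNorm_neg]
    congr 1
    ext x
    simp only [Pi.neg_apply]
    ring
  have hpd (i : Fin N) (φ : E N → ℝ) (x : E N) :
      partialDeriv i (fun y => -φ y) x = -partialDeriv i φ x := by
    simp [partialDeriv, fderiv_fun_neg]
  refine ⟨fun i x => -G i x, ⟨hG.memLp.neg, fun i => (hG.memLp_deriv i).neg, fun i =>
    ⟨(hG.hasWeakPartialDeriv i).locallyIntegrableOn.neg,
      (hG.hasWeakPartialDeriv i).locallyIntegrableOn_deriv.neg, fun φ hφ => ?_⟩⟩, fun φ hφ => ?_,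
    fun k x => -w k x, fun k => (hws k).neg, ?_, fun i => ?_, ?_⟩
  · simp only [neg_mul, integral_neg, (hG.hasWeakPartialDeriv i).integral_eq φ hφ]
  · simp only [abs_neg, mul_neg, neg_mul, Finset.sum_neg_distrib, integral_neg, ← heq φ hφ]
  · simpa only [hneg] using hwu
  · simpa only [hpd, hneg] using hwG i
  · simpa only [hneg] using hwv

theorem IsWeakDirichletSolution.ae_le_of_lt {N : ℕ} (i₀ : Fin N) {p : ℝ} (hp : 2 < p)
    {f : E N → ℝ} {v : UnitSphere N → ℝ} {u : E N → ℝ} (hu : IsWeakDirichletSolution p f v u)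
    (hf : MemLp f ∞ (ballMeasure N)) {F F' M : ℝ} (hF : 0 ≤ F) (hFF' : F < F')
    (hfF : ∀ᵐ x ∂ballMeasure N, -F ≤ f x) (hvM : ∀ᵐ y ∂surfaceMeasure N, v y ≤ M) :
    ∀ᵐ x ∂ballMeasure N, u x ≤ M + Real.exp 2 * F' ^ (1 / (p - 1)) := by
  obtain ⟨G, hG, heq, w, hws, hwu, hwG, hwv⟩ := hu
  have : Nonempty (Fin N) := ⟨i₀⟩
  have hp1 : 1 < p := by linarith
  have hp1' : 0 < p - 1 := by linarith
  have hF' : 0 < F' := hF.trans_lt hFF'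
  -- The factor `e` offsets `exp (x i₀) ≥ e⁻¹` on the ball, so that `(A * exp (x i₀)) ^ (p - 1) ≥
  -- F'`.
  set A : ℝ := Real.exp 1 * F' ^ (1 / (p - 1))
  have hA : 0 < A := by positivity
  set B : ℝ := Real.exp (p - 1) * F'
  have hAB : A ^ (p - 1) = B := by
    simp only [A, B]
    rw [Real.mul_rpow (by positivity) (by positivity), ← Real.exp_mul, one_mul,
      ← Real.rpow_mul hF'.le, one_div_mul_cancel hp1'.ne', Real.rpow_one]
  -- The barrier is at least `M` wherever `x i₀ ≤ 1`, and it depends on one coordinate, so its flux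
  -- has a single nonzero component.
  set b : E N → ℝ := fun x => M + A * (Real.exp 1 - Real.exp (1 * x i₀))
  have hbs : ContDiff ℝ ∞ b :=
    contDiff_const.add (contDiff_const.mul (contDiff_const.sub (contDiff_exp_coord i₀ 1)))
  set W : Fin N → E N → ℝ := fun i x => if i = i₀ then -(A * Real.exp (x i₀)) else 0
  have hbW (i : Fin N) (x : E N) : partialDeriv i b x = W i x := by
    have h := (((hasFDerivAt_exp_coord i₀ 1 x).const_sub (Real.exp 1)).const_mul A).const_add M
    simp only [partialDeriv]
    rw [show fderiv ℝ b x = _ from h.fderiv]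
    by_cases hi : i = i₀
    · subst hi; simp [W]
    · simp [W, hi, Ne.symm hi]
  have hWc (i : Fin N) : Continuous (W i) := by
    have := continuous_partialDeriv hbs i
    rwa [show partialDeriv i b = W i from funext (hbW i)] at this
  have hW (i : Fin N) : MemLp (W i) (ENNReal.ofReal p) (ballMeasure N) := by
    obtain ⟨c, hc⟩ :=
      (isCompact_closedBall (0 : E N) 1).exists_bound_of_continuousOn (hWc i).continuousOn
    refine MemLp.of_bound (hWc i).aestronglyMeasurable c ?_
    filter_upwards [ae_restrict_mem measurableSet_ball] with x hx
    exact hc x (ball_subset_closedBall hx)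
  have hWflux (i : Fin N) (x : E N) : |W i x| ^ (p - 2) * W i x =
      if i = i₀ then -(B * Real.exp ((p - 1) * x i₀)) else 0 := by
    by_cases hi : i = i₀
    · have hpos : 0 < A * Real.exp (x i₀) := by positivity
      have hkey : (A * Real.exp (x i₀)) ^ (p - 2) * (A * Real.exp (x i₀)) =
          B * Real.exp ((p - 1) * x i₀) := by
        rw [← Real.rpow_add_one hpos.ne', show p - 2 + 1 = p - 1 by ring,
          Real.mul_rpow hA.le (Real.exp_pos _).le, hAB, ← Real.exp_mul, mul_comm (x i₀)]
      simp only [W, hi, if_true, abs_neg, abs_of_pos hpos, mul_neg, hkey]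
    · simp [W, hi]
  have hfi : Integrable f (ballMeasure N) := hf.integrable le_top
  have hei : Integrable (fun x : E N => B * Real.exp ((p - 1) * x i₀)) (ballMeasure N) := by
    have := (((contDiff_exp_coord i₀ (p - 1)).continuous.const_mul B).locallyIntegrable
      (μ := (volume : Measure (E N)))).integrableOn_isCompact (isCompact_closedBall 0 1)
    exact this.mono_set ball_subset_closedBall
  have hGf (i : Fin N) := memLp_flux hp (hG.memLp_deriv i)
  have hWf (i : Fin N) := memLp_flux hp (hW i)
  have hq1 : 1 ≤ ENNReal.ofReal p.conjExponent := by
    simpa using (Real.HolderConjugate.conjExponent hp1).symm.lt.le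
  have habs (x : E N) : |x i₀| ≤ ‖x‖ := PiLp.norm_apply_le x i₀
  have hlog := ae_nonpos_of_strict_subsolution (N := N) hp1
    (X := fun i x => |G i x| ^ (p - 2) * G i x - |W i x| ^ (p - 2) * W i x)
    (H := fun i x => G i x - W i x) (h := fun x => (p - 1) * (f x + B * Real.exp ((p - 1) * x i₀)))
    (ε := (p - 1) * (F' - F)) (mul_pos hp1' (sub_pos.2 hFF'))
    (fun i => (hGf i).sub (hWf i)) (fun i => (hG.memLp_deriv i).sub (hW i))
    ((hfi.add hei).const_mul _) ?_ ?_ ?_ (z := fun x => u x - b x)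
    (hG.memLp.1.sub hbs.continuous.aestronglyMeasurable) (ζ := fun k x => w k x - b x)
    (fun k => (hws k).sub hbs) ?_ ?_ ?_
  · filter_upwards [hlog] with x hx
    have h1 : b x ≤ M + A * Real.exp 1 := by
      simp only [b]
      gcongr
      linarith [Real.exp_pos (1 * x i₀)]
    have h2 : A * Real.exp 1 = Real.exp 2 * F' ^ (1 / (p - 1)) := by
      simp only [A]
      rw [show (2 : ℝ) = 1 + 1 by norm_num, Real.exp_add]
      ring
    linarith
  · filter_upwards [hfF, ae_restrict_mem measurableSet_ball] with x hx hxb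
    have hx1 : ‖x‖ < 1 := by simpa using hxb
    have h1 : -(p - 1) ≤ (p - 1) * x i₀ := by
      have := (abs_le.1 (habs x)).1
      nlinarith
    have h2 : F' ≤ B * Real.exp ((p - 1) * x i₀) := by
      calc F' = B * Real.exp (-(p - 1)) := by
            simp only [B]
            rw [mul_right_comm, ← Real.exp_add, add_neg_cancel, Real.exp_zero, one_mul]
        _ ≤ _ := by gcongr
    exact mul_le_mul_of_nonneg_left (by linarith) hp1'.le
  · exact .of_forall fun x => Finset.sum_nonneg fun i _ =>
      flux_sub_mul_sub_nonneg (by linarith) _ _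
  · intro φ hφ
    have hI1 : Integrable (fun x => ∑ i, |G i x| ^ (p - 2) * G i x * partialDeriv i φ x)
        (ballMeasure N) :=
      integrable_finsetSum _ fun i _ => hφ.integrable_mul_partialDeriv ((hGf i).integrable hq1) i
    have hI2 : Integrable (fun x => B * Real.exp ((p - 1) * x i₀) * partialDeriv i₀ φ x)
        (ballMeasure N) := hφ.integrable_mul_partialDeriv hei i₀
    have hsum (x : E N) : ∑ i, (|G i x| ^ (p - 2) * G i x - |W i x| ^ (p - 2) * W i x) *
        partialDeriv i φ x = (∑ i, |G i x| ^ (p - 2) * G i x * partialDeriv i φ x) +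
          B * Real.exp ((p - 1) * x i₀) * partialDeriv i₀ φ x := by
      simp only [hWflux, sub_mul, Finset.sum_sub_distrib, ite_mul, zero_mul,
        Finset.sum_ite_eq', Finset.mem_univ, if_true]
      ring
    have hright (x : E N) : (p - 1) * (f x + B * Real.exp ((p - 1) * x i₀)) * φ x =
        (p - 1) * f x * φ x + (p - 1) * (B * Real.exp ((p - 1) * x i₀) * φ x) := by ring
    simp only [hsum, hright]
    rw [integral_add hI1 hI2, integral_add (hφ.integrable_mul (hfi.const_mul _))
      ((hφ.integrable_mul hei).const_mul _), ← heq φ hφ]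
    simp only [mul_assoc B, integral_const_mul, integral_exp_coord_mul_partialDeriv i₀ (p - 1) hφ]
    ring
  · simpa only [sub_sub_sub_cancel_right] using hwu
  · intro i
    refine (hwG i).congr fun k => ?_
    congr 1
    ext x
    have h1 : partialDeriv i (fun x => w k x - b x) x =
        partialDeriv i (w k) x - partialDeriv i b x := by
      simp only [partialDeriv]
      rw [fderiv_fun_sub ((hws k).differentiable (by simp) x) (hbs.differentiable (by simp) x)]
      rfl
    rw [h1, hbW]
    ring
  · refine tendsto_of_tendsto_of_tendsto_of_le_of_le tendsto_const_nhds hwv (fun _ => zero_le)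
      fun k => ?_
    refine eLpNorm_mono_ae ?_
    filter_upwards [hvM] with y hy
    have hy1 : ‖(y : E N)‖ = 1 := norm_eq_of_mem_sphere y
    have hb : M ≤ b y := by
      have h1 : Real.exp (1 * (y : E N) i₀) ≤ Real.exp 1 := by
        gcongr
        have := (abs_le.1 (habs (y : E N))).2
        linarith
      have := mul_nonneg hA.le (sub_nonneg.2 h1)
      simp only [b]
      linarith
    rw [Real.norm_of_nonneg (le_max_right _ _), Real.norm_eq_abs]
    -- On the sphere `v ≤ M ≤ b`, so the positive part of `w k - b` is at most `|w k - v|`, whose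
    -- norm tends to `0`.
    refine max_le ?_ (abs_nonneg _)
    exact (by linarith : w k y - b y ≤ w k y - v y).trans (le_abs_self _)

/-- Comparison needs the strict gap `F < F'`; taking `F' = F + 1/(n+1)` keeps the exceptional sets
countable in number, and also covers `F = 0`. -/
theorem IsWeakDirichletSolution.ae_le {N : ℕ} (i₀ : Fin N) {p : ℝ} (hp : 2 < p)
    {f : E N → ℝ} {v : UnitSphere N → ℝ} {u : E N → ℝ} (hu : IsWeakDirichletSolution p f v u)
    (hf : MemLp f ∞ (ballMeasure N)) {F M : ℝ} (hF : 0 ≤ F)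
    (hfF : ∀ᵐ x ∂ballMeasure N, -F ≤ f x) (hvM : ∀ᵐ y ∂surfaceMeasure N, v y ≤ M) :
    ∀ᵐ x ∂ballMeasure N, u x ≤ M + Real.exp 2 * F ^ (1 / (p - 1)) := by
  have hall : ∀ᵐ x ∂ballMeasure N, ∀ n : ℕ,
      u x ≤ M + Real.exp 2 * (F + 1 / ((n : ℝ) + 1)) ^ (1 / (p - 1)) :=
    ae_all_iff.2 fun n => hu.ae_le_of_lt i₀ hp hf hF (by simp; positivity) hfF hvM
  have hp1 : 0 ≤ 1 / (p - 1) := one_div_nonneg.2 (by linarith)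
  have hlim : Tendsto (fun n : ℕ => M + Real.exp 2 * (F + 1 / ((n : ℝ) + 1)) ^ (1 / (p - 1)))
      atTop (𝓝 (M + Real.exp 2 * (F + 0) ^ (1 / (p - 1)))) :=
    tendsto_const_nhds.add (tendsto_const_nhds.mul
      ((tendsto_const_nhds.add tendsto_one_div_add_atTop_nhds_zero_nat).rpow_const (Or.inr hp1)))
  rw [add_zero] at hlim
  filter_upwards [hall] with x hx
  exact ge_of_tendsto' hlim hx

end PseudoPLaplace

/-! ### The two-sided estimate, with constant `e²`. -/

theorem proposition2p1 (p : ℝ) (hp : 2 < p) (N : ℕ) (hN : 1 ≤ N) :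
    ∃ C : ℝ≥0, ∀ (f : PseudoPLaplace.E N → ℝ) (v : PseudoPLaplace.UnitSphere N → ℝ)
      (u : PseudoPLaplace.E N → ℝ),
      MemLp f ∞ (PseudoPLaplace.ballMeasure N) →
      MemLp v ∞ (PseudoPLaplace.surfaceMeasure N) →
      PseudoPLaplace.MemFractionalSobolevSphere (1 - 1 / p) p v →
      PseudoPLaplace.IsWeakDirichletSolution p f v u →
      eLpNorm u ∞ (PseudoPLaplace.ballMeasure N) ≤
        (C : ℝ≥0∞) * (eLpNorm f ∞ (PseudoPLaplace.ballMeasure N) ^ (1 / (p - 1)) +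
          eLpNorm v ∞ (PseudoPLaplace.surfaceMeasure N)) := by
  refine ⟨⟨Real.exp 2, (Real.exp_pos 2).le⟩, fun f v u hf hv _ hu => ?_⟩
  set C : ℝ≥0 := ⟨Real.exp 2, (Real.exp_pos 2).le⟩
  have hC : (1 : ℝ≥0∞) ≤ C := by
    have : (1 : ℝ≥0) ≤ C := Real.one_le_exp (by norm_num)
    exact_mod_cast this
  have hp1 : 0 ≤ 1 / (p - 1) := one_div_nonneg.2 (by linarith)
  have bound {α : Type} [MeasurableSpace α] {μ : Measure α} {g : α → ℝ} (hg : MemLp g ∞ μ) :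
      ∀ᵐ x ∂μ, |g x| ≤ (eLpNorm g ∞ μ).toReal := by
    have h := enorm_ae_le_eLpNormEssSup g μ
    rw [← eLpNorm_exponent_top] at h
    filter_upwards [h] with x hx
    have := ENNReal.toReal_mono hg.2.ne hx
    simpa using this
  set F := (eLpNorm f ∞ (PseudoPLaplace.ballMeasure N)).toReal
  set M := (eLpNorm v ∞ (PseudoPLaplace.surfaceMeasure N)).toReal
  have hfF := bound hf
  have hvM := bound hv
  have h1 := hu.ae_le ⟨0, hN⟩ hp hf ENNReal.toReal_nonneg
    (hfF.mono fun x hx => (abs_le.1 hx).1) (hvM.mono fun y hy => (abs_le.1 hy).2)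
  have h2 := hu.neg.ae_le ⟨0, hN⟩ hp hf.neg ENNReal.toReal_nonneg
    (hfF.mono fun x hx => neg_le_neg (abs_le.1 hx).2)
    (hvM.mono fun y hy => neg_le.1 (abs_le.1 hy).1)
  have h3 : ∀ᵐ x ∂PseudoPLaplace.ballMeasure N,
      ‖u x‖ₑ ≤ ENNReal.ofReal (M + Real.exp 2 * F ^ (1 / (p - 1))) := by
    filter_upwards [h1, h2] with x hx hx'
    rw [Real.enorm_eq_ofReal_abs]
    exact ENNReal.ofReal_le_ofReal (abs_le.2 ⟨neg_le.1 hx', hx⟩)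
  rw [eLpNorm_exponent_top]
  refine (eLpNormEssSup_le_of_ae_enorm_bound h3).trans ?_
  rw [ENNReal.ofReal_add ENNReal.toReal_nonneg (by positivity),
    ENNReal.ofReal_mul (Real.exp_pos 2).le, ENNReal.ofReal_toReal hv.2.ne,
    ← ENNReal.ofReal_rpow_of_nonneg ENNReal.toReal_nonneg hp1, ENNReal.ofReal_toReal hf.2.ne,
    mul_add, add_comm, show ENNReal.ofReal (Real.exp 2) = C from ENNReal.ofReal_coe_nnreal (p := C)]
  gcongr
  exact le_mul_of_one_le_left zero_le hC
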